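/- Let $d\ge 3$, $n\in\mathbb N_0$ and $\lambda=\frac{d-2}{2}$. Let $\mathbb S^{d-1}$ be the unit sphere of $\mathbb R^d$, $\sigma$ its surface area measure and $\omega_d=\int_{\mathbb S^{d-1}}d\sigma$. Let $\mathcal H_n^d$ be the space of real harmonic polynomials on $\mathbb R^d$ that are homogeneous of degree $n$, equipped with the inner product $\langle f,g\rangle_{\mathbb S^{d-1}}=\frac1{\omega_d}\int_{\mathbb S^{d-1}}f g\,d\sigma$. Let $C_n^\lambda$ be the Gegenbauer polynomial $$C_n^\lambda(t)=\frac{(\lambda)_n2^n}{n!}\,t^n\,{}_2F_1\!\left(-\tfrac n2,\tfrac{1-n}2;1-n-\lambda;\tfrac1{t^2}\right)=\frac{(\lambda)_n2^n}{n!}\sum_{j=0}^{\lfloor n/2\rfloor}\frac{(-\frac n2)_j(\frac{1-n}2)_j}{j!\,(1-n-\lambda)_j}\,t^{n-2j},$$ where $(a)_j=a(a+1)\cdots(a+j-1)$ and the last sum gives the value also at $t=0$. (i) There is exactly one function $Z_n:\mathbb S^{d-1}\times\mathbb S^{d-1}\to\mathbb R$ such that for each $x\in\mathbb S^{d-1}$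 the function $Z_n(x,\cdot)$ is the restriction to $\mathbb S^{d-1}$ of an element of $\mathcal H_n^d$, and $$\frac1{\omega_d}\int_{\mathbb S^{d-1}}Z_n(x,y)p(y)\,d\sigma(y)=p(x)\qquad\text{for all }p\in\mathcal H_n^d,\ x\in\mathbb S^{d-1}$$ (the reproducing kernel of $\mathcal H_n^d$), and it satisfies $$Z_n(x,y)=\frac{n+\lambda}{\lambda}\,C_n^\lambda(\langle x,y\rangle)\qquad\text{for all }x,y\in\mathbb S^{d-1}.$$ (ii) For every basis $\{Y_j\}$ of $\mathcal H_n^d$ that is orthonormal for $\langle\cdot,\cdot\rangle_{\mathbb S^{d-1}}$, $$\sum_{j=1}^{\dim\mathcal H_n^d}Y_j(x)Y_j(y)=\frac{n+\lambda}{\lambda}\,C_n^\lambda(\langle x,y\rangle)\qquad\text{for all }x,y\in\mathbb S^{d-1}.$$ -/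

import Mathlib

open MeasureTheory
open scoped Nat

noncomputable section

/-- The Laplacian `Δ = ∂₁² + ⋯ + ∂_d²` on real polynomials in `d` variables. -/
def polyLaplacian (d : ℕ) : MvPolynomial (Fin d) ℝ →ₗ[ℝ] MvPolynomial (Fin d) ℝ :=
  ∑ i : Fin d, (MvPolynomial.pderiv i).toLinearMap ∘ₗ (MvPolynomial.pderiv i).toLinearMap

/-- The space `H_n^d` of real harmonic polynomials on `ℝ^d`, homogeneous of degree `n`. -/
def harmonicPoly (d n : ℕ) : Submodule ℝ (MvPolynomial (Fin d) ℝ) :=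
  MvPolynomial.homogeneousSubmodule (Fin d) ℝ n ⊓ LinearMap.ker (polyLaplacian d)

/-- The unit sphere `S^{d-1}` of `ℝ^d` with its Euclidean norm. -/
abbrev UnitSphere (d : ℕ) : Type := Metric.sphere (0 : EuclideanSpace ℝ (Fin d)) 1

/-- The restriction of a polynomial to the unit sphere. -/
def restrictSphere {d : ℕ} (p : MvPolynomial (Fin d) ℝ) (x : UnitSphere d) : ℝ :=
  MvPolynomial.eval (fun i => (x : EuclideanSpace ℝ (Fin d)) i) p

/-- The surface area measure `σ` on the unit sphere. -/
def surfaceMeasure (d : ℕ) : Measure (UnitSphere d) :=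
  (volume : Measure (EuclideanSpace ℝ (Fin d))).toSphere

/-- The total surface area `ω_d = ∫_{S^{d-1}} dσ`. -/
def sphereArea (d : ℕ) : ℝ := ∫ _ : UnitSphere d, (1 : ℝ) ∂(surfaceMeasure d)

/-- The normalized inner product `⟨f, g⟩ = (1 / ω_d) ∫_{S^{d-1}} f g dσ`. -/
def sphereInner {d : ℕ} (f g : UnitSphere d → ℝ) : ℝ :=
  1 / sphereArea d * ∫ y, f y * g y ∂(surfaceMeasure d)

/-- `Z` is a reproducing kernel of `H_n^d`: each `Z(x, ·)` is (the restriction to the sphere of) an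
element of `H_n^d`, and `(1 / ω_d) ∫ Z(x, y) p(y) dσ(y) = p(x)` for all `p ∈ H_n^d` and all `x` in
the sphere. -/
structure IsReproducingKernel (d n : ℕ) (Z : UnitSphere d → UnitSphere d → ℝ) : Prop where
  mem : ∀ x, ∃ q ∈ harmonicPoly d n, Z x = restrictSphere q
  reproducing : ∀ p ∈ harmonicPoly d n, ∀ x,
    sphereInner (Z x) (restrictSphere p) = restrictSphere p x

/-- A family in `H_n^d` is orthonormal for the normalized inner product on the sphere. -/
structure IsSphereOrthonormal {d n : ℕ} {ι : Type*} (Y : ι → harmonicPoly d n) : Prop where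
  norm_one : ∀ i, sphereInner (restrictSphere (Y i : MvPolynomial (Fin d) ℝ))
    (restrictSphere (Y i : MvPolynomial (Fin d) ℝ)) = 1
  orthogonal : ∀ i j, i ≠ j → sphereInner (restrictSphere (Y i : MvPolynomial (Fin d) ℝ))
    (restrictSphere (Y j : MvPolynomial (Fin d) ℝ)) = 0

/-- The Pochhammer symbol `(a)_n = a (a + 1) ⋯ (a + n - 1)`. -/
def poch (a : ℝ) (n : ℕ) : ℝ := (ascPochhammer ℝ n).eval a

/-- The Gegenbauer polynomial
`C_n^λ(t) = ((λ)_n 2^n / n!) t^n ₂F₁(-n/2, (1-n)/2; 1-n-λ; 1/t²)`, used for `λ > 0`. The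
hypergeometric series terminates, the factor `(-n/2)_j ((1-n)/2)_j` being `0` for `j > ⌊n/2⌋`, and
is written out here, so that the polynomial has its right value at `t = 0` too; see
`gegenbauer_eval_eq_hypergeometric`. -/
def gegenbauer (lam : ℝ) (n : ℕ) : Polynomial ℝ :=
  Polynomial.C (poch lam n * 2 ^ n / n !) *
    ∑ j ∈ Finset.range (n / 2 + 1),
      Polynomial.C (poch (-(n : ℝ) / 2) j * poch ((1 - (n : ℝ)) / 2) j /
        (poch (1 - (n : ℝ) - lam) j * j !)) * Polynomial.X ^ (n - 2 * j)

lemma poch_eq_zero_of_lt (n j : ℕ) (h : n / 2 < j) :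
    poch (-(n : ℝ) / 2) j * poch ((1 - (n : ℝ)) / 2) j = 0 := by
  obtain ⟨k, hk | hk⟩ := Nat.even_or_odd' n
  · have h1 : (-(n : ℝ) / 2) = -(k : ℝ) := by subst hk; push_cast; ring
    rw [h1, poch, ascPochhammer_eval_neg_coe_nat_of_lt (by omega), zero_mul]
  · have h1 : ((1 - (n : ℝ)) / 2) = -(k : ℝ) := by subst hk; push_cast; ring
    rw [h1, poch, poch, ascPochhammer_eval_neg_coe_nat_of_lt (by omega), mul_zero]

/-- The Gegenbauer polynomial agrees with its hypergeometric formula wherever the latter makes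
sense, that is, for `t ≠ 0`. -/
theorem gegenbauer_eval_eq_hypergeometric (lam : ℝ) (n : ℕ) (t : ℝ) (ht : t ≠ 0) :
    (gegenbauer lam n).eval t = poch lam n * 2 ^ n / n ! * t ^ n *
      ordinaryHypergeometric (-(n : ℝ) / 2) ((1 - (n : ℝ)) / 2) (1 - (n : ℝ) - lam)
        (1 / t ^ 2) := by
  rw [ordinaryHypergeometric, ordinaryHypergeometric_sum_eq, tsum_eq_sum (s := Finset.range (n / 2 + 1))]
  · simp only [gegenbauer, Polynomial.eval_mul, Polynomial.eval_C, Polynomial.eval_finsetSum,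
      Polynomial.eval_pow, Polynomial.eval_X]
    rw [mul_assoc, Finset.mul_sum (a := t ^ n)]
    congr 1
    refine Finset.sum_congr rfl fun j hj => ?_
    have hj' : 2 * j ≤ n := by rw [Finset.mem_range] at hj; omega
    rw [pow_sub₀ t ht hj', pow_mul]
    simp only [poch, smul_eq_mul, div_eq_mul_inv, mul_inv]
    ring
  · intro j hj
    have h := poch_eq_zero_of_lt n j (by rw [Finset.mem_range] at hj; omega)
    simp only [poch] at h
    rw [mul_assoc ((j ! : ℝ)⁻¹), h]
    simp

end

/-!
Write `M` for the mean over the unit sphere. Integrating a homogeneous polynomial against the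
Gaussian `exp (-‖y‖² / 2)` in polar coordinates gives a positive multiple of its mean, so Gaussian
integration by parts turns into `(d + m) M(yᵢ p) = M(∂ᵢ p)` for `p` of degree `m + 1`. Together with
Euler's identity, this shows that harmonic polynomials of degree `n` are orthogonal to all
polynomials of lower degree, and that `M(⟨x, ·⟩ ^ n p)` is an explicit multiple of `p x` for
`p ∈ H_n^d`. The homogenization of `C_n^λ(⟨x, ·⟩)` by powers of `‖y‖²` is harmonic, because its
Laplacian telescopes, and on the sphere it differs from a multiple of `⟨x, ·⟩ ^ n` by terms of lower
degree; hence it reproduces. Finally, a reproducing kernel is unique: pairing `Z(x, ·)` with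
`W(y, ·)` gives `Z(x, y) = W(y, x)` for any two of them. The sum `∑ Y_j(x) Y_j(y)` is another one.
-/

noncomputable section

open MvPolynomial

section PolynomialAlgebra

variable {σ R : Type*}

lemma eval_smul_of_isHomogeneous [CommSemiring R] {m : ℕ} {p : MvPolynomial σ R}
    (hp : p.IsHomogeneous m) (r : R) (x : σ → R) : eval (r • x) p = r ^ m * eval x p := by
  simp only [eval_eq, Finset.mul_sum]
  refine Finset.sum_congr rfl fun s hs => ?_
  simp only [Pi.smul_apply, smul_eq_mul, mul_pow, Finset.prod_mul_distrib,
    Finset.prod_pow_eq_pow_sum, ← hp.degree_eq_sum_deg_support hs]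
  ring

lemma exists_C_eq_of_isHomogeneous_zero [CommSemiring R] {p : MvPolynomial σ R}
    (hp : p.IsHomogeneous 0) : ∃ a, C a = p := by
  rwa [← mem_homogeneousSubmodule, homogeneousSubmodule_zero, Submodule.mem_one] at hp

/-- The derivative in the direction of a vector `x` of constants. -/
def dirDeriv [CommSemiring R] (x : σ → R) :
    Derivation R (MvPolynomial σ R) (MvPolynomial σ R) :=
  mkDerivation R fun i => C (x i)

lemma dirDeriv_apply [CommSemiring R] [Fintype σ] (x : σ → R) (p : MvPolynomial σ R) :
    dirDeriv x p = ∑ i, C (x i) * pderiv i p := by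
  classical
  induction p using MvPolynomial.induction_on with
  | C a => simp [dirDeriv]
  | add p q hp hq => simp only [map_add, hp, hq, mul_add, Finset.sum_add_distrib]
  | mul_X p i hp =>
    have hX : dirDeriv x (X i) = C (x i) := mkDerivation_X _ _ _
    simp only [Derivation.leibniz, hX, hp, smul_eq_mul, pderiv_X, mul_add,
      Finset.sum_add_distrib, Finset.mul_sum]
    simp [Pi.single_apply, mul_comm, mul_left_comm]

lemma dirDeriv_pderiv_comm [CommRing R] (x : σ → R) (i : σ) (p : MvPolynomial σ R) :
    dirDeriv x (pderiv i p) = pderiv i (dirDeriv x p) := by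
  classical
  have h : ⁅dirDeriv x, pderiv i⁆ = 0 := derivation_ext fun k => by
    rw [Derivation.commutator_apply]
    simp [dirDeriv, pderiv_X, Pi.single_apply, apply_ite]
  rw [← sub_eq_zero, ← Derivation.commutator_apply, h, Derivation.zero_apply]

lemma isHomogeneous_dirDeriv [CommSemiring R] [Finite σ] {m : ℕ} {p : MvPolynomial σ R}
    (hp : p.IsHomogeneous m) (x : σ → R) : (dirDeriv x p).IsHomogeneous (m - 1) := by
  have := Fintype.ofFinite σ
  rw [dirDeriv_apply]
  exact IsHomogeneous.sum _ _ _ fun i _ => hp.pderiv.C_mul (x i)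

lemma eval_dirDeriv_of_isHomogeneous [CommSemiring R] [Finite σ] {m : ℕ} {p : MvPolynomial σ R}
    (hp : p.IsHomogeneous m) (x : σ → R) : eval x (dirDeriv x p) = m * eval x p := by
  have := Fintype.ofFinite σ
  simpa [dirDeriv_apply] using congrArg (eval x) hp.sum_X_mul_pderiv

variable [CommSemiring R] [Fintype σ]

/-- The linear form `y ↦ ∑ i, x i * y i` as a polynomial. -/
def linearForm (x : σ → R) : MvPolynomial σ R := ∑ i, C (x i) * X i

lemma isHomogeneous_linearForm (x : σ → R) : (linearForm x).IsHomogeneous 1 :=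
  IsHomogeneous.sum _ _ _ fun i _ => isHomogeneous_C_mul_X (x i) i

lemma eval_linearForm (x y : σ → R) : eval y (linearForm x) = x ⬝ᵥ y := by
  simp [linearForm, dotProduct]

lemma pderiv_linearForm (x : σ → R) (i : σ) : pderiv i (linearForm x) = C (x i) := by
  classical
  simp [linearForm, pderiv_X, Pi.single_apply]

end PolynomialAlgebra

section Laplacian

variable {d : ℕ}

lemma polyLaplacian_apply (p : MvPolynomial (Fin d) ℝ) :
    polyLaplacian d p = ∑ i, pderiv i (pderiv i p) := by
  simp [polyLaplacian]

lemma polyLaplacian_mul (p q : MvPolynomial (Fin d) ℝ) :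
    polyLaplacian d (p * q) =
      polyLaplacian d p * q + 2 * ∑ i, pderiv i p * pderiv i q + p * polyLaplacian d q := by
  simp only [polyLaplacian_apply, Finset.sum_mul, Finset.mul_sum, ← Finset.sum_add_distrib,
    pderiv_mul, map_add]
  exact Finset.sum_congr rfl fun i _ => by ring

lemma polyLaplacian_dirDeriv (x : Fin d → ℝ) (p : MvPolynomial (Fin d) ℝ) :
    polyLaplacian d (dirDeriv x p) = dirDeriv x (polyLaplacian d p) := by
  simp only [polyLaplacian_apply, map_sum, dirDeriv_pderiv_comm]

lemma polyLaplacian_linearForm_pow (x : Fin d → ℝ) (m : ℕ) :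
    polyLaplacian d (linearForm x ^ m) =
      (m * (m - 1)) • (C (x ⬝ᵥ x) * linearForm x ^ (m - 2)) := by
  have second_pderiv (i : Fin d) : pderiv i (pderiv i (linearForm x ^ m)) =
      (m * (m - 1)) • (C (x i * x i) * linearForm x ^ (m - 2)) := by
    simp only [pderiv_pow, pderiv_mul, pderiv_linearForm, pderiv_C, Derivation.map_natCast,
      Nat.sub_sub, nsmul_eq_mul, Nat.cast_mul, map_mul]
    ring
  simp only [polyLaplacian_apply, second_pderiv, dotProduct, map_sum, Finset.sum_mul,
    Finset.smul_sum]

/-- The polynomial `x₁² + ⋯ + x_d²`, whose value is the square of the Euclidean norm. -/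
def normSqPoly (d : ℕ) : MvPolynomial (Fin d) ℝ := ∑ i, X i ^ 2

lemma isHomogeneous_normSqPoly : (normSqPoly d).IsHomogeneous 2 :=
  IsHomogeneous.sum _ _ _ fun i _ => isHomogeneous_X_pow i 2

lemma pderiv_normSqPoly (i : Fin d) : pderiv i (normSqPoly d) = 2 * X i := by
  simp [normSqPoly, pderiv_X, Pi.single_apply]

lemma polyLaplacian_normSqPoly : polyLaplacian d (normSqPoly d) = (2 * d) • 1 := by
  have second_pderiv (i : Fin d) : pderiv i (pderiv i (normSqPoly d)) = 2 := by
    have pderiv_two : pderiv i (2 : MvPolynomial (Fin d) ℝ) = 0 := (pderiv i).map_natCast 2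
    simp [pderiv_normSqPoly, pderiv_two]
  simp [polyLaplacian_apply, second_pderiv, mul_comm]

lemma polyLaplacian_normSqPoly_mul {m : ℕ} {q : MvPolynomial (Fin d) ℝ}
    (hq : q.IsHomogeneous m) :
    polyLaplacian d (normSqPoly d * q) =
      normSqPoly d * polyLaplacian d q + (2 * (d + 2 * m)) • q := by
  have cross_term : ∑ i, pderiv i (normSqPoly d) * pderiv i q = (2 * m) • q := by
    simp only [pderiv_normSqPoly, mul_assoc, ← Finset.mul_sum, hq.sum_X_mul_pderiv, nsmul_eq_mul,
      Nat.cast_mul, Nat.cast_ofNat]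
  rw [polyLaplacian_mul, polyLaplacian_normSqPoly, cross_term]
  simp only [nsmul_eq_mul]
  push_cast
  ring

lemma polyLaplacian_normSqPoly_pow_succ_mul {m : ℕ} {q : MvPolynomial (Fin d) ℝ}
    (hq : q.IsHomogeneous m) (j : ℕ) :
    polyLaplacian d (normSqPoly d ^ (j + 1) * q) =
      normSqPoly d ^ (j + 1) * polyLaplacian d q +
        (2 * (j + 1) * (d + 2 * m + 2 * j)) • (normSqPoly d ^ j * q) := by
  induction j with
  | zero => simpa using polyLaplacian_normSqPoly_mul hq
  | succ j ih =>
    have hhom : (normSqPoly d ^ (j + 1) * q).IsHomogeneous (2 * (j + 1) + m) :=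
      (isHomogeneous_normSqPoly.pow (j + 1)).mul hq
    rw [pow_succ' _ (j + 1), mul_assoc, polyLaplacian_normSqPoly_mul hhom, ih]
    simp only [nsmul_eq_mul]
    push_cast
    ring

lemma polyLaplacian_sum_normSqPoly_pow_mul_linearForm_pow {x : Fin d → ℝ} (hx : x ⬝ᵥ x = 1)
    {n : ℕ} {a : ℕ → ℝ}
    (ha : ∀ j, 2 * (j + 1) ≤ n → 2 * (j + 1) * (d + 2 * n - 2 * j - 4) * a (j + 1) =
      -((n - 2 * j) * (n - 2 * j - 1) * a j)) {k : ℕ} (hk : 2 * k ≤ n) :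
    polyLaplacian d (∑ j ∈ Finset.range (k + 1),
        a j • (normSqPoly d ^ j * linearForm x ^ (n - 2 * j))) =
      a k • (normSqPoly d ^ k * polyLaplacian d (linearForm x ^ (n - 2 * k))) := by
  induction k with
  | zero => simp
  | succ k ih =>
    obtain ⟨m, rfl⟩ := Nat.exists_eq_add_of_le hk
    have hhom : (linearForm x ^ m).IsHomogeneous m := by
      simpa using (isHomogeneous_linearForm x).pow m
    have hrec := congrArg (C (σ := Fin d)) (ha k hk)
    rw [Finset.sum_range_succ, map_add, ih (by omega), map_smul,
      show 2 * (k + 1) + m - 2 * k = m + 2 by omega, Nat.add_sub_cancel_left,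
      polyLaplacian_linearForm_pow x (m + 2), polyLaplacian_normSqPoly_pow_succ_mul hhom, hx]
    simp only [smul_eq_C_mul, nsmul_eq_mul, Nat.add_sub_cancel, show m + 2 - 1 = m + 1 by omega]
    push_cast at hrec ⊢
    simp only [map_mul, map_add, map_sub, map_neg, map_natCast, map_ofNat, map_one] at hrec ⊢
    linear_combination normSqPoly d ^ k * linearForm x ^ m * hrec

lemma polyLaplacian_sum_normSqPoly_pow_mul_linearForm_pow_eq_zero {x : Fin d → ℝ}
    (hx : x ⬝ᵥ x = 1) {n : ℕ} {a : ℕ → ℝ}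
    (ha : ∀ j, 2 * (j + 1) ≤ n → 2 * (j + 1) * (d + 2 * n - 2 * j - 4) * a (j + 1) =
      -((n - 2 * j) * (n - 2 * j - 1) * a j)) :
    polyLaplacian d (∑ j ∈ Finset.range (n / 2 + 1),
        a j • (normSqPoly d ^ j * linearForm x ^ (n - 2 * j))) = 0 := by
  rw [polyLaplacian_sum_normSqPoly_pow_mul_linearForm_pow hx ha (by omega),
    polyLaplacian_linearForm_pow]
  obtain h | h : n - 2 * (n / 2) = 0 ∨ n - 2 * (n / 2) = 1 := by omega
  all_goals simp [h]

end Laplacian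

section HarmonicPoly

variable {d n : ℕ} {p : MvPolynomial (Fin d) ℝ}

lemma mem_harmonicPoly_iff :
    p ∈ harmonicPoly d n ↔ p.IsHomogeneous n ∧ polyLaplacian d p = 0 := Iff.rfl

lemma dirDeriv_mem_harmonicPoly (hp : p ∈ harmonicPoly d n) (x : Fin d → ℝ) :
    dirDeriv x p ∈ harmonicPoly d (n - 1) := by
  rw [mem_harmonicPoly_iff] at hp ⊢
  exact ⟨isHomogeneous_dirDeriv hp.1 x, by rw [polyLaplacian_dirDeriv, hp.2, map_zero]⟩

lemma pderiv_mem_harmonicPoly (hp : p ∈ harmonicPoly d n) (i : Fin d) :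
    pderiv i p ∈ harmonicPoly d (n - 1) := by
  simpa [dirDeriv_apply, Pi.single_apply] using dirDeriv_mem_harmonicPoly hp (Pi.single i 1)

end HarmonicPoly

section PolarCoordinates

variable {E : Type*} [NormedAddCommGroup E] [NormedSpace ℝ E] [FiniteDimensional ℝ E]
  [Nontrivial E] [MeasurableSpace E] [BorelSpace E] (μ : Measure E) [μ.IsAddHaarMeasure]

lemma integral_eq_integral_norm_mul_average_toSphere {h : E → ℝ} {g : ℝ → ℝ}
    {f : Metric.sphere (0 : E) 1 → ℝ}
    (hgf : ∀ r > 0, ∀ ω : Metric.sphere (0 : E) 1, h (r • (ω : E)) = g r * f ω) :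
    ∫ x, h x ∂μ = (∫ x, g ‖x‖ ∂μ) * ⨍ ω, f ω ∂μ.toSphere := by
  have polar {h : E → ℝ} {f : Metric.sphere (0 : E) 1 → ℝ}
      (hgf : ∀ r > 0, ∀ ω : Metric.sphere (0 : E) 1, h (r • (ω : E)) = g r * f ω) :
      ∫ x, h x ∂μ = (∫ ω, f ω ∂μ.toSphere) *
        ∫ r, g r ∂(Measure.volumeIoiPow (Module.finrank ℝ E - 1)) := by
    have remove_origin : ∫ x, h x ∂μ = ∫ x : ({0}ᶜ : Set E), h x ∂(μ.comap Subtype.val) := by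
      rw [integral_subtype_comap (measurableSet_singleton (0 : E)).compl h,
        restrict_compl_singleton]
    rw [← integral_prod_mul, remove_origin,
      ← μ.measurePreserving_homeomorphUnitSphereProd.integral_comp
        (Homeomorph.measurableEmbedding _)]
    refine integral_congr_ae (.of_forall fun x => ?_)
    have hx := hgf _ (homeomorphUnitSphereProd E x).2.2 (homeomorphUnitSphereProd E x).1
    rwa [← homeomorphUnitSphereProd_symm_apply_coe, Homeomorph.symm_apply_apply, mul_comm] at hx
  have radial := polar (h := fun x => g ‖x‖) (f := 1) fun r hr ω => by
    simp [norm_smul, abs_of_pos hr]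
  have hμ : μ.toSphere.real Set.univ ≠ 0 := by
    rw [Ne, measureReal_eq_zero_iff, Measure.measure_univ_eq_zero]
    exact μ.toSphere_ne_zero
  rw [polar hgf, radial, average_eq]
  simp only [Pi.one_apply, integral_const, smul_eq_mul]
  field_simp

lemma integrable_norm_pow_mul_exp (m : ℕ) :
    Integrable (fun x : E => ‖x‖ ^ m * Real.exp (-‖x‖ ^ 2 / 2)) μ := by
  rw [integrable_fun_norm_addHaar μ (f := fun r => r ^ m * Real.exp (-r ^ 2 / 2))]
  have h := integrable_rpow_mul_exp_neg_mul_sq (b := 1 / 2) (by norm_num)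
    (s := (Module.finrank ℝ E - 1 + m : ℕ)) (neg_one_lt_zero.trans_le (Nat.cast_nonneg _))
  refine (h.congr (.of_forall fun r => ?_)).integrableOn
  simp only [Real.rpow_natCast, smul_eq_mul, pow_add, mul_assoc]
  ring_nf

lemma integral_norm_pow_mul_exp_pos (m : ℕ) :
    0 < ∫ x : E, ‖x‖ ^ m * Real.exp (-‖x‖ ^ 2 / 2) ∂μ := by
  obtain ⟨x, hx⟩ := exists_ne (0 : E)
  exact integral_pos_of_integrable_nonneg_nonzero (x := x) (by fun_prop)
    (integrable_norm_pow_mul_exp μ m) (fun y => by positivity) (by positivity)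

end PolarCoordinates

section GaussianIntegral

variable {σ : Type*}

lemma hasLineDerivAt_eval [DecidableEq σ] (p : MvPolynomial σ ℝ) (y : EuclideanSpace ℝ σ) (i : σ) :
    HasLineDerivAt ℝ (fun y : EuclideanSpace ℝ σ => eval y p) (eval y (pderiv i p)) y
      (EuclideanSpace.single i 1) := by
  unfold HasLineDerivAt
  induction p using MvPolynomial.induction_on with
  | C a => simpa using hasDerivAt_const (0 : ℝ) a
  | add p q hp hq => simpa only [map_add] using! hp.add hq
  | mul_X p j hp =>
    have hX : HasDerivAt (fun t : ℝ => y j + t * Pi.single (M := fun _ => ℝ) i 1 j)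
        (Pi.single (M := fun _ => ℝ) i 1 j) 0 := by
      simpa using ((hasDerivAt_id (0 : ℝ)).mul_const _).const_add (y j)
    convert! hp.mul hX using 1
    · ext t
      simp
    · obtain rfl | hij := eq_or_ne i j
      · simp [add_comm, mul_comm]
      · simp [pderiv_X_of_ne hij.symm, hij, mul_comm]

variable [Fintype σ]

lemma abs_eval_monomial_le (s : σ →₀ ℕ) (a : ℝ) (y : EuclideanSpace ℝ σ) :
    |eval y (monomial s a)| ≤ |a| * ‖y‖ ^ s.degree := by
  rw [eval_monomial, abs_mul, Finsupp.degree_apply, ← Finset.prod_pow_eq_pow_sum, Finsupp.prod,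
    Finset.abs_prod]
  gcongr with i
  rw [abs_pow]
  gcongr
  exact PiLp.norm_apply_le y i

lemma integrable_eval_mul_exp [Nonempty σ] (p : MvPolynomial σ ℝ) :
    Integrable fun y : EuclideanSpace ℝ σ => eval y p * Real.exp (-‖y‖ ^ 2 / 2) := by
  induction p using MvPolynomial.induction_on' with
  | monomial s a =>
    refine ((integrable_norm_pow_mul_exp volume s.degree).const_mul |a|).mono'
      (by have := MvPolynomial.continuous_eval (monomial s a); fun_prop) (.of_forall fun y => ?_)
    rw [norm_mul, Real.norm_eq_abs, Real.norm_of_nonneg (Real.exp_nonneg _), ← mul_assoc]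
    gcongr
    exact abs_eval_monomial_le s a y
  | add p q hp hq => exact (hp.add hq).congr (.of_forall fun y => by simp [add_mul])

/-- The integral of a polynomial against the unnormalized Gaussian weight `exp (-‖y‖² / 2)`. -/
def gaussianIntegral (σ : Type*) [Fintype σ] [Nonempty σ] : MvPolynomial σ ℝ →ₗ[ℝ] ℝ where
  toFun p := ∫ y : EuclideanSpace ℝ σ, eval y p * Real.exp (-‖y‖ ^ 2 / 2)
  map_add' p q := by
    simp only [map_add, add_mul,
      integral_add (integrable_eval_mul_exp p) (integrable_eval_mul_exp q)]
  map_smul' c p := by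
    simp only [smul_eval, mul_assoc, integral_const_mul, RingHom.id_apply, smul_eq_mul]

lemma hasLineDerivAt_exp_neg_norm_sq [DecidableEq σ] (y : EuclideanSpace ℝ σ) (i : σ) :
    HasLineDerivAt ℝ (fun y : EuclideanSpace ℝ σ => Real.exp (-‖y‖ ^ 2 / 2))
      (-(y i * Real.exp (-‖y‖ ^ 2 / 2))) y (EuclideanSpace.single i 1) := by
  have h := ((hasStrictFDerivAt_norm_sq y).hasFDerivAt.neg.mul_const (1 / 2 : ℝ)).exp.hasLineDerivAt
    (EuclideanSpace.single i 1)
  convert! h using 1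
  · ext
    simp [div_eq_mul_inv]
  · simp [EuclideanSpace.inner_single_right, div_eq_mul_inv]
    ring

lemma gaussianIntegral_X_mul [Nonempty σ] (i : σ) (p : MvPolynomial σ ℝ) :
    gaussianIntegral σ (X i * p) = gaussianIntegral σ (pderiv i p) := by
  classical
  have by_parts := integral_bilinear_hasLineDerivAt_right_eq_neg_left_of_integrable
    (μ := (volume : Measure (EuclideanSpace ℝ σ))) (B := ContinuousLinearMap.mul ℝ ℝ)
    (integrable_eval_mul_exp (pderiv i p))
    ((integrable_eval_mul_exp (X i * p)).neg.congr (.of_forall fun y => by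
      simp only [Pi.neg_apply, map_mul, eval_X, ContinuousLinearMap.mul_apply']; ring))
    (integrable_eval_mul_exp p) (fun y _ => hasLineDerivAt_eval p y i)
    fun y _ => hasLineDerivAt_exp_neg_norm_sq y i
  simp only [ContinuousLinearMap.mul_apply', mul_neg, integral_neg, neg_inj] at by_parts
  simpa [gaussianIntegral, mul_comm, mul_left_comm, mul_assoc] using by_parts

lemma gaussianIntegral_normSqPoly_mul {d m : ℕ} [NeZero d] {p : MvPolynomial (Fin d) ℝ}
    (hp : p.IsHomogeneous m) :
    gaussianIntegral (Fin d) (normSqPoly d * p) = (d + m) * gaussianIntegral (Fin d) p := by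
  calc gaussianIntegral (Fin d) (normSqPoly d * p)
      = ∑ i, gaussianIntegral (Fin d) (X i * (X i * p)) := by
        simp only [normSqPoly, sq, Finset.sum_mul, map_sum, mul_assoc]
    _ = gaussianIntegral (Fin d) (∑ i, (X i * pderiv i p + p)) := by
        simp only [gaussianIntegral_X_mul, map_sum, pderiv_mul, pderiv_X_self, one_mul, add_comm]
    _ = (d + m) * gaussianIntegral (Fin d) p := by
        rw [Finset.sum_add_distrib, hp.sum_X_mul_pderiv, Finset.sum_const, Finset.card_fin,
          ← add_smul, map_nsmul, nsmul_eq_mul, add_comm, Nat.cast_add]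

end GaussianIntegral

section SphereMean

variable {d : ℕ}

lemma dotProduct_self_eq_one (x : UnitSphere d) : x.1 ⬝ᵥ x.1 = 1 := by
  have h := EuclideanSpace.real_norm_sq_eq x.1
  rw [norm_eq_of_mem_sphere] at h
  simp [dotProduct, ← sq, ← h]

lemma restrictSphere_normSqPoly (x : UnitSphere d) : restrictSphere (normSqPoly d) x = 1 := by
  simpa [restrictSphere, normSqPoly, dotProduct, sq] using dotProduct_self_eq_one x

instance isFiniteMeasure_surfaceMeasure : IsFiniteMeasure (surfaceMeasure d) := by
  unfold surfaceMeasure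
  infer_instance

instance neZero_surfaceMeasure [NeZero d] : NeZero (surfaceMeasure d) :=
  ⟨Measure.toSphere_ne_zero _⟩

lemma integrable_restrictSphere (p : MvPolynomial (Fin d) ℝ) :
    Integrable (restrictSphere p) (surfaceMeasure d) := by
  have hp : Continuous (restrictSphere p) := by
    have := MvPolynomial.continuous_eval p
    unfold restrictSphere
    fun_prop
  exact hp.integrable_of_hasCompactSupport (HasCompactSupport.of_compactSpace _)

/-- The mean value of a polynomial over the unit sphere, with respect to surface area. -/
def sphereMean (d : ℕ) : MvPolynomial (Fin d) ℝ →ₗ[ℝ] ℝ where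
  toFun p := ⨍ y, restrictSphere p y ∂(surfaceMeasure d)
  map_add' p q := by
    rw [average_eq, average_eq, average_eq, ← smul_add,
      ← integral_add (integrable_restrictSphere p) (integrable_restrictSphere q)]
    simp only [restrictSphere, map_add]
  map_smul' c p := by
    simp only [average_eq, restrictSphere, smul_eval, integral_const_mul, smul_eq_mul,
      RingHom.id_apply, mul_left_comm]

lemma sphereInner_restrictSphere (p q : MvPolynomial (Fin d) ℝ) :
    sphereInner (restrictSphere p) (restrictSphere q) = sphereMean d (p * q) := by
  simp [sphereInner, sphereArea, sphereMean, average_eq, restrictSphere]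

lemma sphereMean_C [NeZero d] (a : ℝ) : sphereMean d (C a) = a := by
  simp [sphereMean, restrictSphere]

lemma sphereMean_normSqPoly_pow_mul (j : ℕ) (p : MvPolynomial (Fin d) ℝ) :
    sphereMean d (normSqPoly d ^ j * p) = sphereMean d p := by
  have h (y : UnitSphere d) : restrictSphere (normSqPoly d ^ j * p) y = restrictSphere p y := by
    have := restrictSphere_normSqPoly y
    simp_all [restrictSphere]
  simp [sphereMean, h]

variable [NeZero d]

lemma gaussianIntegral_eq_mul_sphereMean {m : ℕ} {p : MvPolynomial (Fin d) ℝ}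
    (hp : p.IsHomogeneous m) :
    gaussianIntegral (Fin d) p =
      (∫ y : EuclideanSpace ℝ (Fin d), ‖y‖ ^ m * Real.exp (-‖y‖ ^ 2 / 2)) * sphereMean d p := by
  refine integral_eq_integral_norm_mul_average_toSphere volume
    (g := fun r => r ^ m * Real.exp (-r ^ 2 / 2)) fun r hr ω => ?_
  rw [norm_smul, norm_eq_of_mem_sphere, Real.norm_of_nonneg hr.le, mul_one, WithLp.ofLp_smul,
    eval_smul_of_isHomogeneous hp, mul_right_comm]
  rfl

lemma sphereMean_X_mul {m : ℕ} {p : MvPolynomial (Fin d) ℝ} (hp : p.IsHomogeneous (m + 1))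
    (i : Fin d) : (d + m) * sphereMean d (X i * p) = sphereMean d (pderiv i p) := by
  have hpderiv : (pderiv i p).IsHomogeneous m := by simpa using hp.pderiv (i := i)
  have hX : (X i * p).IsHomogeneous (m + 2) := by
    simpa [add_comm, add_left_comm] using (isHomogeneous_X ℝ i).mul hp
  have hnormSq : (normSqPoly d * pderiv i p).IsHomogeneous (m + 2) := by
    simpa [add_comm] using isHomogeneous_normSqPoly.mul hpderiv
  refine mul_left_cancel₀ (integral_norm_pow_mul_exp_pos
    (volume : Measure (EuclideanSpace ℝ (Fin d))) (m + 2)).ne' ?_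
  rw [mul_left_comm, ← gaussianIntegral_eq_mul_sphereMean hX, gaussianIntegral_X_mul,
    ← gaussianIntegral_normSqPoly_mul hpderiv, gaussianIntegral_eq_mul_sphereMean hnormSq,
    ← pow_one (normSqPoly d), sphereMean_normSqPoly_pow_mul]

lemma sphereMean_linearForm_mul {m : ℕ} {p : MvPolynomial (Fin d) ℝ}
    (hp : p.IsHomogeneous (m + 1)) (x : Fin d → ℝ) :
    (d + m) * sphereMean d (linearForm x * p) = sphereMean d (dirDeriv x p) := by
  simp only [linearForm, dirDeriv_apply, Finset.sum_mul, ← smul_eq_C_mul, smul_mul_assoc, map_sum,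
    map_smul, Finset.mul_sum, smul_eq_mul, mul_left_comm _ (x _), sphereMean_X_mul hp]

lemma sphereMean_eq_zero_of_mem_harmonicPoly {n : ℕ} (hn : n ≠ 0) {q : MvPolynomial (Fin d) ℝ}
    (hq : q ∈ harmonicPoly d n) : sphereMean d q = 0 := by
  have euler : (n : ℝ) * gaussianIntegral (Fin d) q = 0 := by
    rw [← nsmul_eq_mul, ← map_nsmul, ← hq.1.sum_X_mul_pderiv, map_sum]
    simp_rw [gaussianIntegral_X_mul]
    rw [← map_sum, ← polyLaplacian_apply, hq.2, map_zero]
  rw [gaussianIntegral_eq_mul_sphereMean hq.1] at euler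
  simpa [hn, (integral_norm_pow_mul_exp_pos (volume : Measure (EuclideanSpace ℝ (Fin d))) n).ne']
    using euler

lemma sphereMean_mul_eq_zero_of_lt {k n : ℕ} {f q : MvPolynomial (Fin d) ℝ}
    (hf : f.IsHomogeneous k) (hq : q ∈ harmonicPoly d n) (hkn : k < n) :
    sphereMean d (f * q) = 0 := by
  induction k using Nat.strong_induction_on generalizing f n q with | _ k ih
  rcases k with _ | k
  · obtain ⟨a, rfl⟩ := exists_C_eq_of_isHomogeneous_zero hf
    rw [← smul_eq_C_mul, map_smul, sphereMean_eq_zero_of_mem_harmonicPoly hkn.ne' hq, smul_zero]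
  · have by_parts (i : Fin d) : sphereMean d (X i * (pderiv i f * q)) = 0 := by
      have hhom : (pderiv i f * q).IsHomogeneous (k + n - 1 + 1) := by
        convert hf.pderiv.mul hq.1 using 1
        omega
      have h := sphereMean_X_mul hhom i
      rw [pderiv_mul, map_add, ih (k - 1) (by omega) hf.pderiv.pderiv hq (by omega),
        ih k (by omega) hf.pderiv (pderiv_mem_harmonicPoly hq i) (by omega), add_zero] at h
      exact (mul_eq_zero.mp h).resolve_left (by have := NeZero.pos d; positivity)
    have euler : ((k + 1 : ℕ) : ℝ) * sphereMean d (f * q) = 0 := by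
      rw [← nsmul_eq_mul, ← map_nsmul, ← smul_mul_assoc, ← hf.sum_X_mul_pderiv, Finset.sum_mul,
        map_sum]
      simp only [mul_assoc, by_parts, Finset.sum_const_zero]
    exact (mul_eq_zero.mp euler).resolve_left (by positivity)

end SphereMean

section Gegenbauer

lemma poch_succ (a : ℝ) (k : ℕ) : poch a (k + 1) = poch a k * (a + k) :=
  ascPochhammer_succ_eval k a

lemma poch_mul_add (a : ℝ) (n : ℕ) : poch a n * (a + n) = a * poch (a + 1) n := by
  induction n with
  | zero => simp [poch]
  | succ n ih =>
    rw [poch_succ, ih, poch_succ]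
    push_cast
    ring

/-- The coefficient of `t ^ (n - 2 * j)` in the Gegenbauer polynomial `C_n^λ(t)`, up to the factor
`(λ)_n 2 ^ n / n!` in front of the hypergeometric series. -/
def gegenbauerCoeff (lam : ℝ) (n j : ℕ) : ℝ :=
  poch (-(n : ℝ) / 2) j * poch ((1 - (n : ℝ)) / 2) j / (poch (1 - (n : ℝ) - lam) j * j !)

lemma gegenbauerCoeff_zero (lam : ℝ) (n : ℕ) : gegenbauerCoeff lam n 0 = 1 := by
  simp [gegenbauerCoeff, poch]

lemma gegenbauerCoeff_succ {lam : ℝ} (hlam : 0 < lam) {n j : ℕ} (hj : j + 1 ≤ n) :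
    4 * (j + 1) * (n + lam - 1 - j) * gegenbauerCoeff lam n (j + 1) =
      -((n - 2 * j) * (n - 2 * j - 1) * gegenbauerCoeff lam n j) := by
  have hj' : (j : ℝ) + 1 ≤ n := by exact_mod_cast hj
  have hden : 1 - (n : ℝ) - lam + j ≠ 0 := by linarith
  have ratio : gegenbauerCoeff lam n (j + 1) =
      (-(n : ℝ) / 2 + j) * ((1 - (n : ℝ)) / 2 + j) / ((1 - (n : ℝ) - lam + j) * (j + 1)) *
        gegenbauerCoeff lam n j := by
    simp only [gegenbauerCoeff, poch_succ, Nat.factorial_succ, Nat.cast_mul, Nat.cast_succ]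
    rw [div_mul_div_comm]
    congr 1 <;> ring
  rw [ratio]
  field_simp
  ring

lemma eval_gegenbauer (lam : ℝ) (n : ℕ) (t : ℝ) :
    (gegenbauer lam n).eval t = poch lam n * 2 ^ n / n ! *
      ∑ j ∈ Finset.range (n / 2 + 1), gegenbauerCoeff lam n j * t ^ (n - 2 * j) := by
  simp [gegenbauer, gegenbauerCoeff, Polynomial.eval_finsetSum]

end Gegenbauer

section ZonalHarmonic

variable {d n : ℕ} {lam : ℝ}

lemma sphereMean_linearForm_pow_mul [NeZero d] (x : Fin d → ℝ) {q : MvPolynomial (Fin d) ℝ}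
    (hq : q ∈ harmonicPoly d n) :
    2 ^ n * poch (d / 2) n * sphereMean d (linearForm x ^ n * q) = n ! * eval x q := by
  induction n generalizing q with
  | zero =>
    obtain ⟨a, rfl⟩ := exists_C_eq_of_isHomogeneous_zero hq.1
    simp [sphereMean_C, poch]
  | succ n ih =>
    have hhom : (linearForm x ^ n * q).IsHomogeneous (2 * n + 1) := by
      convert ((isHomogeneous_linearForm x).pow n).mul hq.1 using 1
      ring
    have lower_order : sphereMean d (dirDeriv x (linearForm x ^ n) * q) = 0 :=
      sphereMean_mul_eq_zero_of_lt (isHomogeneous_dirDeriv ((isHomogeneous_linearForm x).pow n) x)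
        hq (by omega)
    have by_parts := sphereMean_linearForm_mul hhom x
    rw [Derivation.leibniz, map_add, smul_eq_mul, smul_eq_mul, mul_comm q, lower_order, add_zero,
      ← mul_assoc, ← pow_succ'] at by_parts
    have ih := ih (dirDeriv_mem_harmonicPoly hq x)
    rw [eval_dirDeriv_of_isHomogeneous hq.1, ← by_parts] at ih
    rw [poch_succ, Nat.factorial_succ]
    push_cast at ih ⊢
    linear_combination ih

/-- The homogenization of `(n + λ) / λ * C_n^λ(⟨x, y⟩)`, as a polynomial in `y`: a harmonic
polynomial for `λ = (d - 2) / 2` and unit vectors `x`. -/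
def zonalHarmonic (lam : ℝ) (n : ℕ) (x : Fin d → ℝ) : MvPolynomial (Fin d) ℝ :=
  ((n + lam) / lam * (poch lam n * 2 ^ n / n !)) •
    ∑ j ∈ Finset.range (n / 2 + 1),
      gegenbauerCoeff lam n j • (normSqPoly d ^ j * linearForm x ^ (n - 2 * j))

lemma isHomogeneous_zonalHarmonic (x : Fin d → ℝ) :
    (zonalHarmonic lam n x).IsHomogeneous n := by
  refine (homogeneousSubmodule (Fin d) ℝ n).smul_mem _ <| Submodule.sum_mem _ fun j hj =>
    Submodule.smul_mem _ _ ?_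
  have hj : 2 * j + 1 * (n - 2 * j) = n := by
    rw [Finset.mem_range] at hj
    omega
  simpa only [mem_homogeneousSubmodule, hj] using
    (isHomogeneous_normSqPoly.pow j).mul ((isHomogeneous_linearForm x).pow (n - 2 * j))

lemma zonalHarmonic_mem_harmonicPoly (hd : 3 ≤ d) (hlam : lam = (d - 2) / 2) {x : Fin d → ℝ}
    (hx : x ⬝ᵥ x = 1) : zonalHarmonic lam n x ∈ harmonicPoly d n := by
  have hd' : (3 : ℝ) ≤ d := by exact_mod_cast hd
  refine mem_harmonicPoly_iff.mpr ⟨isHomogeneous_zonalHarmonic x, ?_⟩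
  rw [zonalHarmonic, map_smul,
    polyLaplacian_sum_normSqPoly_pow_mul_linearForm_pow_eq_zero hx fun j hj => ?_, smul_zero]
  rw [← gegenbauerCoeff_succ (by linarith) (by omega), hlam]
  ring

lemma restrictSphere_zonalHarmonic (lam : ℝ) (n : ℕ) (x y : UnitSphere d) :
    restrictSphere (zonalHarmonic lam n x.1) y =
      (n + lam) / lam * (gegenbauer lam n).eval (inner ℝ x.1 y.1) := by
  have hnorm : eval y.1 (normSqPoly d) = 1 := restrictSphere_normSqPoly y
  have hinner : x.1 ⬝ᵥ y.1 = inner ℝ x.1 y.1 := by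
    simp [EuclideanSpace.inner_eq_star_dotProduct, dotProduct_comm]
  simp only [restrictSphere, zonalHarmonic, smul_eval, map_sum, map_mul, map_pow, hnorm, one_pow,
    one_mul, eval_linearForm, hinner, eval_gegenbauer, mul_assoc]

lemma sphereMean_zonalHarmonic_mul (hd : 3 ≤ d) (hlam : lam = (d - 2) / 2) (x : Fin d → ℝ)
    {p : MvPolynomial (Fin d) ℝ} (hp : p ∈ harmonicPoly d n) :
    sphereMean d (zonalHarmonic lam n x * p) = eval x p := by
  have : NeZero d := ⟨by omega⟩
  have hlam_pos : 0 < lam := by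
    have : (3 : ℝ) ≤ d := by exact_mod_cast hd
    linarith
  have only_leading_term : sphereMean d ((∑ j ∈ Finset.range (n / 2 + 1),
      gegenbauerCoeff lam n j • (normSqPoly d ^ j * linearForm x ^ (n - 2 * j))) * p) =
      sphereMean d (linearForm x ^ n * p) := by
    simp only [Finset.sum_mul, map_sum, smul_mul_assoc, map_smul, mul_assoc,
      sphereMean_normSqPoly_pow_mul]
    rw [Finset.sum_eq_single 0 (fun j hj hj0 => ?_) (by simp), gegenbauerCoeff_zero, one_smul,
      mul_zero, Nat.sub_zero]
    rw [Finset.mem_range] at hj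
    rw [sphereMean_mul_eq_zero_of_lt ((isHomogeneous_linearForm x).pow _) hp (by omega), smul_zero]
  have leading_term := sphereMean_linearForm_pow_mul x hp
  have hd2 : (d / 2 : ℝ) = lam + 1 := by linarith
  rw [zonalHarmonic, smul_mul_assoc, map_smul, only_leading_term, smul_eq_mul]
  rw [hd2] at leading_term
  field_simp
  linear_combination 2 ^ n * sphereMean d (linearForm x ^ n * p) * poch_mul_add lam n +
    lam * leading_term

end ZonalHarmonic

section ReproducingKernel

variable {d n : ℕ}

lemma sphereInner_comm (f g : UnitSphere d → ℝ) : sphereInner f g = sphereInner g f := by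
  simp only [sphereInner, mul_comm]

namespace IsReproducingKernel

variable {Z W : UnitSphere d → UnitSphere d → ℝ}

lemma apply_eq_apply_swap (hZ : IsReproducingKernel d n Z) (hW : IsReproducingKernel d n W)
    (x y : UnitSphere d) : Z x y = W y x := by
  obtain ⟨p, hp, hZp⟩ := hZ.mem x
  obtain ⟨q, hq, hWq⟩ := hW.mem y
  rw [hZp, hWq, ← hW.reproducing p hp, ← hZ.reproducing q hq, hZp, hWq, sphereInner_comm]

lemma unique (hZ : IsReproducingKernel d n Z) (hW : IsReproducingKernel d n W) : Z = W := by
  ext x y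
  rw [hZ.apply_eq_apply_swap hW, hW.apply_eq_apply_swap hW]

end IsReproducingKernel

lemma isReproducingKernel_gegenbauer (hd : 3 ≤ d) (n : ℕ) {lam : ℝ} (hlam : lam = (d - 2) / 2) :
    IsReproducingKernel d n fun x y =>
      (n + lam) / lam * (gegenbauer lam n).eval (inner ℝ x.1 y.1) := by
  simp only [← restrictSphere_zonalHarmonic]
  refine ⟨fun x => ⟨_, zonalHarmonic_mem_harmonicPoly hd hlam (dotProduct_self_eq_one x), rfl⟩,
    fun p hp x => ?_⟩
  rw [sphereInner_restrictSphere]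
  exact sphereMean_zonalHarmonic_mul hd hlam x.1 hp

lemma IsSphereOrthonormal.sphereMean_sum_smul_mul {ι : Type*} [Fintype ι]
    {Y : ι → harmonicPoly d n} (hY : IsSphereOrthonormal Y) (c : ι → ℝ) (k : ι) :
    sphereMean d ((∑ j, c j • (Y j : MvPolynomial (Fin d) ℝ)) * Y k) = c k := by
  rw [Finset.sum_mul, map_sum, Finset.sum_eq_single k (fun j _ hjk => ?_) (by simp)]
  · rw [smul_mul_assoc, map_smul, ← sphereInner_restrictSphere, hY.norm_one, smul_eq_mul, mul_one]
  · rw [smul_mul_assoc, map_smul, ← sphereInner_restrictSphere, hY.orthogonal j k hjk, smul_zero]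

lemma IsSphereOrthonormal.isReproducingKernel {ι : Type*} [Fintype ι]
    {Y : Module.Basis ι ℝ (harmonicPoly d n)} (hY : IsSphereOrthonormal Y) :
    IsReproducingKernel d n fun x y => ∑ j,
      restrictSphere (Y j : MvPolynomial (Fin d) ℝ) x *
        restrictSphere (Y j : MvPolynomial (Fin d) ℝ) y := by
  let K (x : UnitSphere d) : MvPolynomial (Fin d) ℝ :=
    ∑ j, restrictSphere (Y j : MvPolynomial (Fin d) ℝ) x • (Y j : MvPolynomial (Fin d) ℝ)
  have restrict_K (x y : UnitSphere d) : ∑ j, restrictSphere (Y j : MvPolynomial (Fin d) ℝ) x *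
      restrictSphere (Y j : MvPolynomial (Fin d) ℝ) y = restrictSphere (K x) y := by
    simp [K, restrictSphere]
  have reproducing (x : UnitSphere d) : (sphereMean d ∘ₗ LinearMap.mulLeft ℝ (K x)) ∘ₗ
      (harmonicPoly d n).subtype = (aeval x.1).toLinearMap ∘ₗ (harmonicPoly d n).subtype :=
    Y.ext fun k => hY.sphereMean_sum_smul_mul _ k
  simp only [restrict_K]
  refine ⟨fun x => ⟨_, Submodule.sum_mem _ fun j _ => Submodule.smul_mem _ _ (Y j).2, rfl⟩,
    fun p hp x => ?_⟩
  rw [sphereInner_restrictSphere]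
  exact LinearMap.congr_fun (reproducing x) ⟨p, hp⟩

end ReproducingKernel

end

theorem mainTheorem1 (d : ℕ) (hd : 3 ≤ d) (n : ℕ) (lam : ℝ) (hlam : lam = ((d : ℝ) - 2) / 2) :
    (∃! Z : UnitSphere d → UnitSphere d → ℝ, IsReproducingKernel d n Z) ∧
    (∀ Z : UnitSphere d → UnitSphere d → ℝ, IsReproducingKernel d n Z →
      ∀ x y : UnitSphere d, Z x y = ((n : ℝ) + lam) / lam *
        (gegenbauer lam n).eval
          (inner ℝ (x : EuclideanSpace ℝ (Fin d)) (y : EuclideanSpace ℝ (Fin d)))) ∧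
    (∀ (ι : Type*) [Fintype ι] (Y : Module.Basis ι ℝ (harmonicPoly d n)),
      IsSphereOrthonormal Y →
      ∀ x y : UnitSphere d,
        ∑ j, restrictSphere (Y j : MvPolynomial (Fin d) ℝ) x *
            restrictSphere (Y j : MvPolynomial (Fin d) ℝ) y =
          ((n : ℝ) + lam) / lam *
            (gegenbauer lam n).eval
              (inner ℝ (x : EuclideanSpace ℝ (Fin d)) (y : EuclideanSpace ℝ (Fin d)))) := by
  have hC := isReproducingKernel_gegenbauer hd n hlam
  exact ⟨⟨_, hC, fun Z hZ => hZ.unique hC⟩,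
    fun Z hZ x y => congrFun₂ (hZ.unique hC) x y,
    fun ι _ Y hY x y => congrFun₂ (hY.isReproducingKernel.unique hC) x y⟩
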